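/- Let $m,n,r\in\mathbb N$, $M\in\mathbb R^{m\times n}$ and $p\geqslant 1$ (a real number). Equip $E:=\mathbb R^{m\times r}\times\mathbb R^{n\times r}$ with the Frobenius inner product $\langle (X,Y),(X',Y')\rangle=\sum_{i,k}X_{ik}X'_{ik}+\sum_{j,k}Y_{jk}Y'_{jk}$, let $C\subset E$ be the set of pairs $(X,Y)$ of entrywise nonnegative matrices, and let $$\Phi(X,Y):=\frac1p\sum_{i=1}^m\sum_{j=1}^n\bigl|(XY^{\mathsf T}-M)_{ij}\bigr|^p+\delta_C(X,Y),$$ where $\delta_C$ is $0$ on $C$ and $+\infty$ off $C$. Let $\partial\Phi$ be the Clarke subdifferential: $v\in\partial\Phi(z)$ if $\Phi(z)$ is finite and $(v,-1)$ belongs to the Clarke normal cone (the polar of the Clarke tangent cone) of the epigraph of $\Phi$ at $(z,\Phi(z))$. A subgradient trajectory of $\Phi$ is a function $z:I\to E$ on an interval $I\subset[0,\infty)$, absolutely continuous on the compact subintervals of $I$, with $z'(t)\in-\partial\Phi(z(t))$ for almost every $t\in I$, which is maximal, i.e. it cannot be extended to such a function on a strictly larger interval contained in $[0,\infty)$; it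 is initialized at $z_0$ if $0\in I$ and $z(0)=z_0$. Then for every $z_0=(X_0,Y_0)$ with $\Phi(z_0)<\infty$ there exists a unique subgradient trajectory $z=(X,Y)$ of $\Phi$ initialized at $z_0$; it is defined on $[0,\infty)$, and it is bounded. Moreover, along this trajectory the column-wise balances are conserved, $$\sum_{i=1}^m X_{ik}(t)^2-\sum_{j=1}^n Y_{jk}(t)^2=\sum_{i=1}^m X_{ik}(0)^2-\sum_{j=1}^n Y_{jk}(0)^2\qquad\text{for all } t\geqslant0,\ 1\leqslant k\leqslant r,$$ and the entrywise products are bounded: there is $d>0$ with $|X_{ik}(t)Y_{jk}(t)|\leqslant d$ for all $t\geqslant0$ and all $i,j,k$. -/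

import Mathlib

open Set Filter Topology

noncomputable section

namespace NMFlow

/-- The effective domain of an extended-real-valued function. -/
def dom {E : Type*} (Φ : E → EReal) : Set E := {x | Φ x < ⊤}

/-- The Clarke (regular) tangent cone to `C` at `x`, in its sequential form: `v` is tangent if for
all sequences `xₖ → x` in `C` and `tₖ ↓ 0` there are `vₖ → v` with `xₖ + tₖ vₖ ∈ C`. -/
def clarkeTangentCone {F : Type*} [NormedAddCommGroup F] [NormedSpace ℝ F]
    (C : Set F) (x : F) : Set F :=
  {v | ∀ (u : ℕ → F) (t : ℕ → ℝ), (∀ k, u k ∈ C) → Tendsto u atTop (𝓝 x) →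
    (∀ k, 0 < t k) → Tendsto t atTop (𝓝 0) →
    ∃ w : ℕ → F, Tendsto w atTop (𝓝 v) ∧ ∀ k, u k + t k • w k ∈ C}

/-- The Clarke normal cone: the polar of the Clarke tangent cone. -/
def clarkeNormalCone {F : Type*} [NormedAddCommGroup F] [InnerProductSpace ℝ F]
    (C : Set F) (x : F) : Set F :=
  {n | ∀ v ∈ clarkeTangentCone C x, inner ℝ n v ≤ 0}

/-- The epigraph `{(x, s) : Φ x ≤ s}`, a subset of the Hilbert sum of `E` and `ℝ`. -/
def epi {E : Type*} (Φ : E → EReal) : Set (WithLp 2 (E × ℝ)) :=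
  {q | Φ q.fst ≤ (q.snd : EReal)}

/-- The Clarke subdifferential of an extended-real-valued function: `v ∈ ∂Φ(x)` if `Φ x` is finite
and `(v, -1)` is a Clarke normal to the epigraph of `Φ` at `(x, Φ x)`. -/
def clarkeSubdifferential {E : Type*} [NormedAddCommGroup E] [InnerProductSpace ℝ E]
    (Φ : E → EReal) (x : E) : Set E :=
  {v | Φ x ≠ ⊤ ∧ Φ x ≠ ⊥ ∧
    WithLp.toLp 2 (v, (-1 : ℝ)) ∈
      clarkeNormalCone (epi Φ) (WithLp.toLp 2 (x, (Φ x).toReal))}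

/-- `x` is a solution of the differential inclusion `x' ∈ -D(x)` on the interval `I ⊆ [0, ∞)`:
it is absolutely continuous (on every compact subinterval of `I`) and satisfies the inclusion at
almost every `t ∈ I`. Only the values of `x` on `I` are relevant. -/
structure IsSolution {E : Type*} [NormedAddCommGroup E] [NormedSpace ℝ E]
    (D : E → Set E) (I : Set ℝ) (x : ℝ → E) : Prop where
  ordConnected : I.OrdConnected
  subset_nonneg : I ⊆ Ici 0
  absolutelyContinuous : ∀ a ∈ I, ∀ b ∈ I, AbsolutelyContinuousOnInterval x a b
  inclusion : ∀ᵐ t : ℝ, t ∈ I → ∃ v ∈ D (x t), HasDerivAt x (-v) t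

/-- A trajectory of `D`: a solution of `x' ∈ -D(x)` that has no proper extension to a larger
interval of `[0, ∞)`. -/
structure IsTrajectory {E : Type*} [NormedAddCommGroup E] [NormedSpace ℝ E]
    (D : E → Set E) (I : Set ℝ) (x : ℝ → E) : Prop where
  isSolution : IsSolution D I x
  maximal : ∀ (J : Set ℝ) (y : ℝ → E), IsSolution D J y → I ⊆ J → EqOn y x I → J = I

/-- A subgradient trajectory of `Φ`: a trajectory of its Clarke subdifferential. -/
def IsSubgradientTrajectory {E : Type*} [NormedAddCommGroup E] [InnerProductSpace ℝ E]
    (Φ : E → EReal) (I : Set ℝ) (x : ℝ → E) : Prop :=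
  IsTrajectory (clarkeSubdifferential Φ) I x

/-- The space `ℝ^{m×r} × ℝ^{n×r}` of pairs of matrices with the Frobenius inner product. -/
abbrev FactorPair (m n r : ℕ) : Type :=
  WithLp 2 (EuclideanSpace ℝ (Fin m × Fin r) × EuclideanSpace ℝ (Fin n × Fin r))

/-- The first matrix `X` of a pair `(X, Y)`. -/
def FactorPair.X {m n r : ℕ} (z : FactorPair m n r) : Matrix (Fin m) (Fin r) ℝ :=
  Matrix.of fun i k => z.fst (i, k)

/-- The second matrix `Y` of a pair `(X, Y)`. -/
def FactorPair.Y {m n r : ℕ} (z : FactorPair m n r) : Matrix (Fin n) (Fin r) ℝ :=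
  Matrix.of fun j k => z.snd (j, k)

/-- The set `C` of pairs of entrywise nonnegative matrices. -/
def nonnegPairs (m n r : ℕ) : Set (FactorPair m n r) :=
  {z | (∀ i k, 0 ≤ z.X i k) ∧ (∀ j k, 0 ≤ z.Y j k)}

open Classical in
/-- The indicator function `δ_C` of convex analysis. -/
def convexIndicator {E : Type*} (C : Set E) (x : E) : EReal := if x ∈ C then 0 else ⊤

/-- `f(X, Y) = (1/p) ‖X Yᵀ - M‖_p^p` with the entrywise `ℓ_p` norm. -/
def lpLoss {m n r : ℕ} (p : ℝ) (M : Matrix (Fin m) (Fin n) ℝ) (z : FactorPair m n r) : ℝ :=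
  1 / p * ∑ i, ∑ j, |(z.X * z.Y.transpose - M) i j| ^ p

/-- `Φ = f + δ_C`. -/
def nmfObjective {m n r : ℕ} (p : ℝ) (M : Matrix (Fin m) (Fin n) ℝ) (z : FactorPair m n r) :
    EReal :=
  (lpLoss p M z : EReal) + convexIndicator (nonnegPairs m n r) z

end NMFlow

end

/-! The loss is a convex function of the bilinear residual `X Yᵀ - M`, hence convex up to a
quadratic error on bounded sets (`locallySemiconvex_comp`). With a convex constraint, Clarke
subgradients at points of a ball satisfy the convex subgradient inequality up to `K * ‖y - x‖ ^ 2`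
(`LocallySemiconvex.exists_subgradient_ineq`). Conversely, this inequality near a point produces a
Clarke subgradient (`mem_clarkeSubdifferential_of_local_ineq`). Everything about the flow goes
through this inequality.

Uniqueness: the subdifferential is monotone up to a linear term, so Gronwall applies to the squared
distance of two solutions. Existence: implicit Euler iterates stay bounded on finite time intervals
because the loss is nonnegative, and they satisfy a discrete evolution variational inequality. That
inequality contains no derivative, so it survives a pointwise limit; where the limit is
differentiable it becomes the subgradient inequality again.

The loss is unchanged when a column of `X` is multiplied by `c > 0` and the same column of `Y` by
`c⁻¹`. Subgradients are therefore orthogonal to the generator of this scaling, and the balances are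
conserved. The loss never exceeds its initial value, so by nonnegativity no product `X i k * Y j k`
can be large; together with the balances this bounds the trajectory. -/

noncomputable section

namespace NMFlow

/-! ### Absolute continuity and an almost-everywhere Gronwall inequality -/

section AbsolutelyContinuous

/-- Post-composition with a locally Lipschitz map preserves absolute continuity. -/
theorem _root_.AbsolutelyContinuousOnInterval.locallyLipschitz_comp
    {E F : Type*} [NormedAddCommGroup E] [NormedAddCommGroup F]
    {z : ℝ → E} {g : E → F} {a b : ℝ}
    (hz : AbsolutelyContinuousOnInterval z a b) (hg : LocallyLipschitz g) :
    AbsolutelyContinuousOnInterval (fun t => g (z t)) a b := by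
  obtain ⟨K, hK⟩ := (hg.locallyLipschitzOn (s := z '' uIcc a b)).exists_lipschitzOnWith_of_compact
    (isCompact_uIcc.image_of_continuousOn hz.continuousOn)
  rw [absolutelyContinuousOnInterval_iff] at hz ⊢
  intro ε hε
  obtain ⟨δ, hδ, h⟩ := hz (ε / (K + 1)) (by positivity)
  refine ⟨δ, hδ, fun I hI hlen => ?_⟩
  calc ∑ i ∈ Finset.range I.1, dist (g (z (I.2 i).1)) (g (z (I.2 i).2))
      ≤ ∑ i ∈ Finset.range I.1, (K : ℝ) * dist (z (I.2 i).1) (z (I.2 i).2) :=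
        Finset.sum_le_sum fun i hi => hK.dist_le_mul _ (mem_image_of_mem z (hI.1 i hi).1) _
          (mem_image_of_mem z (hI.1 i hi).2)
    _ = K * ∑ i ∈ Finset.range I.1, dist (z (I.2 i).1) (z (I.2 i).2) := by rw [Finset.mul_sum]
    _ ≤ K * (ε / (K + 1)) := by gcongr; exact (h I hI hlen).le
    _ < (K + 1) * (ε / (K + 1)) := by gcongr; linarith
    _ = ε := by field_simp

/-- Gronwall's inequality for absolutely continuous functions vanishing at the left endpoint. -/
theorem _root_.AbsolutelyContinuousOnInterval.nonpos_of_ae_hasDerivAt_le_mul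
    {φ : ℝ → ℝ} {a b c : ℝ} (hab : a ≤ b) (hφ : AbsolutelyContinuousOnInterval φ a b)
    (h₀ : φ a = 0) (h : ∀ᵐ t, t ∈ Icc a b → ∃ d, HasDerivAt φ d t ∧ d ≤ c * φ t) :
    φ b ≤ 0 := by
  -- Integrating factor: `e * φ` is absolutely continuous with derivative at most `0` almost
  -- everywhere, so its increment, the integral of that derivative, is nonpositive.
  set e : ℝ → ℝ := fun t => Real.exp (-c * t)
  have hed : ∀ t, HasDerivAt e (Real.exp (-c * t) * -c) t := fun t => by
    simpa only [mul_one, id] using ((hasDerivAt_id t).const_mul (-c)).exp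
  have he : AbsolutelyContinuousOnInterval e a b := by
    refine ContDiffOn.absolutelyContinuousOnInterval (ContDiff.contDiffOn ?_)
    fun_prop
  have hint := (he.fun_mul hφ).integral_deriv_eq_sub
  have hle : ∫ t in a..b, deriv (fun t => e t * φ t) t ≤ 0 := by
    rw [intervalIntegral.integral_of_le hab]
    refine MeasureTheory.integral_nonpos_of_ae ?_
    rw [Filter.EventuallyLE, MeasureTheory.ae_restrict_iff' measurableSet_Ioc]
    filter_upwards [h] with t ht htI
    obtain ⟨d, hd, hdc⟩ := ht (Ioc_subset_Icc_self htI)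
    rw [HasDerivAt.deriv (f := fun t => e t * φ t) ((hed t).mul hd)]
    have : 0 < Real.exp (-c * t) := Real.exp_pos _
    simp only [Pi.zero_apply, e]
    nlinarith
  rw [hint, h₀] at hle
  have : 0 < e b := Real.exp_pos _
  simp only [mul_zero, sub_zero] at hle
  exact nonpos_of_mul_nonpos_right hle this

end AbsolutelyContinuous

/-! ### Epigraphs, Clarke subgradients and semiconvexity -/

section Constrained

variable {E : Type*} {f : E → ℝ} {C : Set E}

/-- The function `f + δ_C`. -/
def constrained (f : E → ℝ) (C : Set E) (x : E) : EReal := (f x : EReal) + convexIndicator C x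

theorem constrained_of_mem {x : E} (hx : x ∈ C) : constrained f C x = f x := by
  simp [constrained, convexIndicator, hx]

theorem constrained_of_notMem {x : E} (hx : x ∉ C) : constrained f C x = ⊤ := by
  simp [constrained, convexIndicator, hx]

theorem mem_epi_constrained {q : WithLp 2 (E × ℝ)} :
    q ∈ epi (constrained f C) ↔ q.fst ∈ C ∧ f q.fst ≤ q.snd := by
  by_cases h : q.fst ∈ C
  · simp [epi, constrained_of_mem h, h]
  · simp [epi, constrained_of_notMem h, h]

end Constrained

theorem tendsto_toLp_prod {E α : Type*} [NormedAddCommGroup E] {l : Filter α} {a : α → E}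
    {b : α → ℝ} {x : E} {s : ℝ} (ha : Tendsto a l (𝓝 x)) (hb : Tendsto b l (𝓝 s)) :
    Tendsto (fun k => WithLp.toLp 2 (a k, b k)) l (𝓝 (WithLp.toLp 2 (x, s))) :=
  ((WithLp.prod_continuous_toLp 2 E ℝ).tendsto (x, s)).comp (ha.prodMk_nhds hb)

section Clarke

variable {E : Type*} [NormedAddCommGroup E] [InnerProductSpace ℝ E]

/-- `f` is semiconvex on bounded sets. -/
def LocallySemiconvex (f : E → ℝ) : Prop :=
  ∀ R : ℝ, ∃ K : ℝ, 0 ≤ K ∧ ∀ x y : E, ‖x‖ ≤ R → ‖y‖ ≤ R → ∀ t ∈ Icc (0 : ℝ) 1,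
    f (x + t • (y - x)) ≤ (1 - t) * f x + t * f y + K * t * ‖y - x‖ ^ 2

variable {f : E → ℝ} {C : Set E}

theorem mem_of_mem_clarkeSubdifferential {x v : E}
    (h : v ∈ clarkeSubdifferential (constrained f C) x) : x ∈ C := by
  by_contra hx
  exact h.1 (constrained_of_notMem hx)

/-- A Clarke subgradient has nonpositive pairing with tangents of the epigraph. -/
theorem inner_le_of_mem_clarkeSubdifferential {x v : E}
    (h : v ∈ clarkeSubdifferential (constrained f C) x) {d : E} {s : ℝ}
    (hd : WithLp.toLp 2 (d, s) ∈
      clarkeTangentCone (epi (constrained f C)) (WithLp.toLp 2 (x, f x))) :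
    inner ℝ v d ≤ s := by
  have hx := mem_of_mem_clarkeSubdifferential h
  have := h.2.2
  rw [constrained_of_mem hx, EReal.toReal_coe] at this
  have := this _ hd
  simp [WithLp.prod_inner_apply] at this
  linarith

/-- Tangents of the epigraph built from a family of curves that starts at every nearby point. -/
theorem mem_clarkeTangentCone_epi {x d : E} {s : ℝ} {a : E → ℝ → ℝ → E} {b : E → ℝ → ℝ → ℝ}
    (ha : Tendsto (fun q : E × ℝ × ℝ => a q.1 q.2.1 q.2.2) (𝓝 (x, f x, 0)) (𝓝 d))
    (hb : Tendsto (fun q : E × ℝ × ℝ => b q.1 q.2.1 q.2.2) (𝓝 (x, f x, 0)) (𝓝 s))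
    (h : ∀ᶠ q : E × ℝ × ℝ in 𝓝 (x, f x, 0), q.1 ∈ C → f q.1 ≤ q.2.1 → 0 < q.2.2 →
      q.1 + q.2.2 • a q.1 q.2.1 q.2.2 ∈ C ∧
      f (q.1 + q.2.2 • a q.1 q.2.1 q.2.2) ≤ q.2.1 + q.2.2 * b q.1 q.2.1 q.2.2) :
    WithLp.toLp 2 (d, s) ∈
      clarkeTangentCone (epi (constrained f C)) (WithLp.toLp 2 (x, f x)) := by
  classical
  intro u t hu hux ht ht0
  have hq : Tendsto (fun k => ((u k).fst, (u k).snd, t k)) atTop (𝓝 (x, f x, 0)) := by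
    have := ((WithLp.prod_continuous_ofLp 2 E ℝ).tendsto _).comp hux
    exact (this.fst_nhds).prodMk_nhds ((this.snd_nhds).prodMk_nhds ht0)
  set w : ℕ → WithLp 2 (E × ℝ) := fun k =>
    WithLp.toLp 2 (a (u k).fst (u k).snd (t k), b (u k).fst (u k).snd (t k)) with hw
  have hev : ∀ᶠ k in atTop, u k + t k • w k ∈ epi (constrained f C) := by
    filter_upwards [hq.eventually h] with k hk
    obtain ⟨h1, h2⟩ := mem_epi_constrained.1 (hu k)
    rw [mem_epi_constrained]
    simpa [hw] using hk h1 h2 (ht k)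
  -- The curves enter the epigraph only for large `k`. Before that the direction `0` is used, which
  -- stays at `u k`.
  refine ⟨fun k => if u k + t k • w k ∈ epi (constrained f C) then w k else 0, ?_, fun k => ?_⟩
  · refine (tendsto_toLp_prod (ha.comp hq) (hb.comp hq)).congr' ?_
    filter_upwards [hev] with k hk
    exact (if_pos hk).symm
  · by_cases hk : u k + t k • w k ∈ epi (constrained f C)
    · simpa only [if_pos hk] using hk
    · simpa [hk] using hu k

/-- Clarke subgradients of a semiconvex function under a convex constraint satisfy the
subgradient inequality up to a quadratic term, locally uniformly. -/
theorem LocallySemiconvex.exists_subgradient_ineq (hf : LocallySemiconvex f)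
    (hC : Convex ℝ C) (R : ℝ) :
    ∃ K : ℝ, 0 ≤ K ∧ ∀ x v y : E, v ∈ clarkeSubdifferential (constrained f C) x → y ∈ C →
      ‖x‖ ≤ R → ‖y‖ ≤ R → f x + inner ℝ v (y - x) ≤ f y + K * ‖y - x‖ ^ 2 := by
  -- Tangency is tested at base points near `x`, which may leave the ball of radius `R`.
  obtain ⟨K, hK, h⟩ := hf (R + 1)
  refine ⟨K, hK, fun x v y hv hy hxR hyR => ?_⟩
  -- From a nearby epigraph point the curve heads straight for `y`. The slope `b` uses the height
  -- `s` of that point instead of the value of `f` there, so that it is continuous and the bound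
  -- holds above the graph too.
  have key := inner_le_of_mem_clarkeSubdifferential hv
    (d := y - x) (s := f y - f x + K * ‖y - x‖ ^ 2)
    (mem_clarkeTangentCone_epi (a := fun x _ _ => y - x)
      (b := fun x s _ => f y - s + K * ‖y - x‖ ^ 2) ?_ ?_ ?_)
  · linarith
  · exact Continuous.tendsto' (by fun_prop) _ _ rfl
  · exact Continuous.tendsto' (by fun_prop) _ _ rfl
  · have h1 : ∀ᶠ q : E × ℝ × ℝ in 𝓝 (x, f x, 0), ‖q.1‖ < R + 1 :=
      (isOpen_lt (by fun_prop) continuous_const).mem_nhds (show ‖x‖ < R + 1 by linarith)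
    have h2 : ∀ᶠ q : E × ℝ × ℝ in 𝓝 (x, f x, 0), q.2.2 < 1 :=
      (isOpen_lt (by fun_prop) continuous_const).mem_nhds (show (0 : ℝ) < 1 by norm_num)
    filter_upwards [h1, h2] with q hq1 hq2 hqC hqf hq0
    refine ⟨hC.add_smul_sub_mem hqC hy ⟨hq0.le, hq2.le⟩, ?_⟩
    have := h q.1 y hq1.le (by linarith) q.2.2 ⟨hq0.le, hq2.le⟩
    nlinarith [mul_le_mul_of_nonneg_left hqf (sub_nonneg.2 hq2.le)]

/-- A local proximal subgradient is a Clarke subgradient. -/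
theorem mem_clarkeSubdifferential_of_local_ineq {x v : E} {K ε : ℝ} (hx : x ∈ C) (hε : 0 < ε)
    (h : ∀ y ∈ C, ‖y - x‖ < ε → f x + inner ℝ v (y - x) ≤ f y + K * ‖y - x‖ ^ 2) :
    v ∈ clarkeSubdifferential (constrained f C) x := by
  refine ⟨by simp [constrained_of_mem hx], by simp [constrained_of_mem hx], fun d hd => ?_⟩
  rw [constrained_of_mem hx, EReal.toReal_coe] at hd
  have ht0 : Tendsto (fun k : ℕ => 1 / ((k : ℝ) + 1)) atTop (𝓝 0) :=
    tendsto_one_div_add_atTop_nhds_zero_nat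
  -- Only the constant base sequence is needed; the quadratic error disappears after division by the
  -- step.
  obtain ⟨w, hw, hwC⟩ := hd (fun _ => WithLp.toLp 2 (x, f x)) (fun k : ℕ => 1 / ((k : ℝ) + 1))
    (fun _ => mem_epi_constrained.2 ⟨hx, le_rfl⟩) tendsto_const_nhds (fun k => by positivity) ht0
  have hw' := ((WithLp.prod_continuous_ofLp 2 E ℝ).tendsto _).comp hw
  have hw1 : Tendsto (fun k => (w k).fst) atTop (𝓝 d.fst) := hw'.fst_nhds
  have hw2 : Tendsto (fun k => (w k).snd) atTop (𝓝 d.snd) := hw'.snd_nhds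
  have hsmall : ∀ᶠ k : ℕ in atTop, ‖(1 / ((k : ℝ) + 1)) • (w k).fst‖ < ε := by
    have := (ht0.smul hw1).norm
    rw [zero_smul, norm_zero] at this
    exact this.eventually_lt_const hε
  have hlim : inner ℝ v d.fst - d.snd ≤ 0 := by
    have hr : Tendsto (fun k : ℕ => K * (1 / ((k : ℝ) + 1)) * ‖(w k).fst‖ ^ 2) atTop (𝓝 0) := by
      simpa using (ht0.const_mul K).mul (hw1.norm.pow 2)
    refine le_of_tendsto_of_tendsto ((tendsto_const_nhds.inner hw1).sub hw2) hr ?_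
    filter_upwards [hsmall] with k hk
    obtain ⟨h1, h2⟩ := mem_epi_constrained.1 (hwC k)
    simp only [WithLp.add_fst, WithLp.smul_fst, WithLp.add_snd, WithLp.smul_snd,
      smul_eq_mul, WithLp.toLp_fst, WithLp.toLp_snd] at h1 h2
    have := h _ h1 (by simpa using hk)
    rw [add_sub_cancel_left, inner_smul_right, norm_smul, Real.norm_eq_abs, mul_pow, sq_abs]
      at this
    have ht : 0 < 1 / ((k : ℝ) + 1) := by positivity
    have h3 : 1 / ((k : ℝ) + 1) * (inner ℝ v (w k).fst - (w k).snd) ≤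
        1 / ((k : ℝ) + 1) * (K * (1 / ((k : ℝ) + 1)) * ‖(w k).fst‖ ^ 2) := by
      nlinarith
    exact le_of_mul_le_mul_left h3 ht
  simp only [WithLp.prod_inner_apply]
  simp
  linarith

end Clarke

/-! ### Uniqueness of solutions -/

section Uniqueness

variable {E : Type*} [NormedAddCommGroup E] [InnerProductSpace ℝ E] {f : E → ℝ} {C : Set E}

theorem locallyLipschitz_norm_sq : LocallyLipschitz fun x : E => ‖x‖ ^ 2 :=
  ContDiff.locallyLipschitz (𝕂 := ℝ) (contDiff_norm_sq ℝ)

/-- Solutions of the subgradient inclusion are determined by their value at `0`. -/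
theorem LocallySemiconvex.eq_of_isSolution (hf : LocallySemiconvex f) (hC : Convex ℝ C)
    {I J : Set ℝ} {z w : ℝ → E} (hz : IsSolution (clarkeSubdifferential (constrained f C)) I z)
    (hw : IsSolution (clarkeSubdifferential (constrained f C)) J w) {T : ℝ} (hT : 0 ≤ T)
    (h0I : 0 ∈ I) (hTI : T ∈ I) (h0J : 0 ∈ J) (hTJ : T ∈ J) (h0 : z 0 = w 0) : z T = w T := by
  have hzT := hz.absolutelyContinuous 0 h0I T hTI
  have hwT := hw.absolutelyContinuous 0 h0J T hTJ
  obtain ⟨R₁, hR₁⟩ := hzT.exists_bound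
  obtain ⟨R₂, hR₂⟩ := hwT.exists_bound
  rw [uIcc_of_le hT] at hR₁ hR₂
  obtain ⟨K, hK, hineq⟩ := hf.exists_subgradient_ineq hC (max R₁ R₂)
  have hac : AbsolutelyContinuousOnInterval (fun t => ‖z t - w t‖ ^ 2) 0 T :=
    (hzT.fun_sub hwT).locallyLipschitz_comp (g := fun x => ‖x‖ ^ 2) locallyLipschitz_norm_sq
  have hder : ∀ᵐ t : ℝ, t ∈ Icc 0 T → ∃ d, HasDerivAt (fun t => ‖z t - w t‖ ^ 2) d t ∧
      d ≤ 4 * K * ‖z t - w t‖ ^ 2 := by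
    filter_upwards [hz.inclusion, hw.inclusion] with t h1 h2 ht
    obtain ⟨v, hv, hzv⟩ := h1 (hz.ordConnected.out h0I hTI ht)
    obtain ⟨u, hu, hwu⟩ := h2 (hw.ordConnected.out h0J hTJ ht)
    refine ⟨_, (hzv.sub hwu).norm_sq, ?_⟩
    have hz' := (hR₁ t ht).trans (le_max_left R₁ R₂)
    have hw' := (hR₂ t ht).trans (le_max_right R₁ R₂)
    -- Each subgradient is tested at the other point. In the sum the values of `f` cancel, leaving
    -- `2 * K * ‖z t - w t‖ ^ 2`.
    have i1 := hineq _ v _ hv (mem_of_mem_clarkeSubdifferential hu) hz' hw'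
    have i2 := hineq _ u _ hu (mem_of_mem_clarkeSubdifferential hv) hw' hz'
    have e1 : inner ℝ v (w t - z t) = -inner ℝ (z t - w t) v := by
      rw [← neg_sub, inner_neg_right, real_inner_comm]
    rw [norm_sub_rev (w t) (z t), e1] at i1
    rw [real_inner_comm] at i2
    simp only [Pi.sub_apply, inner_sub_right, inner_neg_right] at *
    linarith
  have hle := hac.nonpos_of_ae_hasDerivAt_le_mul hT (by simp [h0]) hder
  exact sub_eq_zero.1 (norm_eq_zero.1 (pow_eq_zero_iff two_ne_zero |>.1
    (le_antisymm hle (by positivity))))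

end Uniqueness

/-! ### The implicit Euler step -/

section ProximalStep

variable {E : Type*} [NormedAddCommGroup E] {f : E → ℝ} {C : Set E}
  {τ : ℝ} {x x' : E}

/-- `x'` is obtained from `x` by an implicit Euler step of length `τ` for `f + δ_C`. -/
def IsProximalStep (f : E → ℝ) (C : Set E) (τ : ℝ) (x x' : E) : Prop :=
  x' ∈ C ∧ ∀ y ∈ C, f x' + ‖x' - x‖ ^ 2 / (2 * τ) ≤ f y + ‖y - x‖ ^ 2 / (2 * τ)

theorem IsProximalStep.sq_norm_sub_le (h : IsProximalStep f C τ x x') (hx : x ∈ C) :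
    ‖x' - x‖ ^ 2 / (2 * τ) ≤ f x - f x' := by
  have := h.2 x hx
  simp only [sub_self, norm_zero] at this
  norm_num at this
  linarith

theorem IsProximalStep.le (h : IsProximalStep f C τ x x') (hτ : 0 < τ) (hx : x ∈ C) :
    f x' ≤ f x := by
  have := h.sq_norm_sub_le hx
  have : 0 ≤ ‖x' - x‖ ^ 2 / (2 * τ) := by positivity
  linarith

/-- From `a ≤ a ^ 2 / (2 * τ) + τ / 2`. The decrease of `f` telescopes over many steps, which bounds
the iterates before any Lipschitz constant is available. -/
theorem IsProximalStep.norm_sub_le (h : IsProximalStep f C τ x x') (hτ : 0 < τ) (hx : x ∈ C) :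
    ‖x' - x‖ ≤ f x - f x' + τ / 2 := by
  have h1 := h.sq_norm_sub_le hx
  have h2 : ‖x' - x‖ - τ / 2 ≤ ‖x' - x‖ ^ 2 / (2 * τ) := by
    rw [le_div_iff₀ (by positivity)]
    nlinarith [sq_nonneg (‖x' - x‖ - τ)]
  linarith

theorem IsProximalStep.norm_sub_le_of_lipschitz (h : IsProximalStep f C τ x x') (hτ : 0 < τ)
    (hx : x ∈ C) {L : ℝ} (hL : 0 ≤ L) (hf : f x - f x' ≤ L * ‖x' - x‖) :
    ‖x' - x‖ ≤ 2 * L * τ := by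
  have h1 := (h.sq_norm_sub_le hx).trans hf
  rw [div_le_iff₀ (by positivity)] at h1
  rcases (norm_nonneg (x' - x)).eq_or_lt with h0 | h0
  · rw [← h0]; positivity
  · nlinarith

variable [InnerProductSpace ℝ E]

theorem exists_isProximalStep [FiniteDimensional ℝ E] (hC : IsClosed C) (hfc : Continuous f)
    (hf0 : ∀ x, 0 ≤ f x) (hτ : 0 < τ) (hx : x ∈ C) : ∃ x', IsProximalStep f C τ x x' := by
  have : ProperSpace E := FiniteDimensional.proper_real E
  have hg : Continuous fun y => f y + ‖y - x‖ ^ 2 / (2 * τ) := by fun_prop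
  obtain ⟨x', hx', hmin⟩ := hg.continuousOn.exists_isMinOn' hC hx (by
    refine Filter.Eventually.filter_mono inf_le_left ?_
    -- If `‖y - x‖` is at least `1` and at least `f x * (2 * τ)`, so is its square, and `y` cannot
    -- beat `x`.
    filter_upwards [(tendsto_dist_right_cocompact_atTop x).eventually_ge_atTop
      (max 1 (f x * (2 * τ)))] with y hy
    rw [dist_eq_norm] at hy
    have h1 := (le_max_left _ _).trans hy
    have h2 := (le_max_right _ _).trans hy
    have h3 : f x ≤ ‖y - x‖ ^ 2 / (2 * τ) := by
      rw [le_div_iff₀ (by positivity)]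
      nlinarith
    simp only [sub_self, norm_zero]
    have := hf0 y
    norm_num
    linarith)
  exact ⟨x', hx', fun y hy => hmin hy⟩

/-- Expanding the square around `x'` turns minimality into a proximal inequality. Its constant `1 /
(2 * τ)` blows up as `τ → 0`, but membership in the Clarke subdifferential gives back, through
semiconvexity, a constant independent of `τ`. -/
theorem IsProximalStep.mem_clarkeSubdifferential (h : IsProximalStep f C τ x x') (hτ : 0 < τ) :
    (1 / τ) • (x - x') ∈ clarkeSubdifferential (constrained f C) x' := by
  refine mem_clarkeSubdifferential_of_local_ineq (K := 1 / (2 * τ)) h.1 one_pos fun y hy _ => ?_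
  have h1 := h.2 y hy
  have h2 := norm_sub_sq_real (y - x') (x - x')
  rw [sub_sub_sub_cancel_right, real_inner_comm] at h2
  rw [h2, norm_sub_rev x' x] at h1
  rw [inner_smul_left]
  simp only [conj_trivial]
  have h3 : (‖y - x'‖ ^ 2 - 2 * inner ℝ (x - x') (y - x') + ‖x - x'‖ ^ 2) / (2 * τ) =
    1 / (2 * τ) * ‖y - x'‖ ^ 2 - 1 / τ * inner ℝ (x - x') (y - x') + ‖x - x'‖ ^ 2 / (2 * τ) := by
    field_simp
  linarith

/-- The discrete evolution variational inequality. -/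
theorem evi_of_subgradient_ineq (hτ : 0 < τ) {y : E} {K : ℝ}
    (hK : f x' + inner ℝ ((1 / τ) • (x - x')) (y - x') ≤ f y + K * ‖y - x'‖ ^ 2) :
    ‖y - x'‖ ^ 2 - ‖y - x‖ ^ 2 ≤ 2 * τ * (f y - f x' + K * ‖y - x'‖ ^ 2) := by
  have h2 := norm_sub_sq_real (y - x') (x - x')
  rw [sub_sub_sub_cancel_right, real_inner_comm] at h2
  rw [inner_smul_left] at hK
  simp only [conj_trivial] at hK
  have h3 : 2 * τ * (1 / τ * inner ℝ (x - x') (y - x')) = 2 * inner ℝ (x - x') (y - x') := by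
    field_simp
  have h4 : 0 ≤ 2 * τ * (f y + K * ‖y - x'‖ ^ 2 - f x' - 1 / τ * inner ℝ (x - x') (y - x')) :=
    mul_nonneg (by positivity) (by linarith)
  nlinarith [sq_nonneg ‖x - x'‖]

end ProximalStep

/-! ### Uniform estimates for the implicit Euler scheme -/

section ProximalSequence

variable {E : Type*} [NormedAddCommGroup E] {f : E → ℝ} {C : Set E}

/-- The iterates of the implicit Euler scheme with step `τ` started at `z₀`. -/
structure IsProximalSequence (f : E → ℝ) (C : Set E) (z₀ : E) (τ : ℝ) (x : ℕ → E) : Prop where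
  zero : x 0 = z₀
  mem : ∀ k, x k ∈ C
  step : ∀ k, IsProximalStep f C τ (x k) (x (k + 1))
  pos : 0 < τ

namespace IsProximalSequence

variable {z₀ : E} {τ : ℝ} {x : ℕ → E}

theorem apply_le (h : IsProximalSequence f C z₀ τ x) (k : ℕ) : f (x k) ≤ f z₀ := by
  induction k with
  | zero => rw [h.zero]
  | succ k ih => exact ((h.step k).le h.pos (h.mem k)).trans ih

theorem norm_sub_le (h : IsProximalSequence f C z₀ τ x) (hf0 : ∀ x, 0 ≤ f x) (k : ℕ) :
    ‖x k - z₀‖ ≤ f z₀ + k * τ := by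
  have key : ‖x k - z₀‖ ≤ f z₀ - f (x k) + k * τ := by
    induction k with
    | zero => simp [h.zero]
    | succ k ih =>
      have h1 := norm_sub_le_norm_sub_add_norm_sub (x (k + 1)) (x k) z₀
      have h2 := (h.step k).norm_sub_le h.pos (h.mem k)
      have := h.pos
      push_cast
      linarith
  linarith [hf0 (x k)]

theorem norm_le (h : IsProximalSequence f C z₀ τ x) (hf0 : ∀ x, 0 ≤ f x) {T : ℝ} {k : ℕ}
    (hk : k * τ ≤ T) : ‖x k‖ ≤ ‖z₀‖ + f z₀ + T := by
  have h1 := h.norm_sub_le hf0 k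
  have h2 := norm_le_norm_add_norm_sub' (x k) z₀
  linarith

end IsProximalSequence

/-- A locally Lipschitz function is Lipschitz on balls of a proper space. -/
theorem _root_.LocallyLipschitz.exists_lipschitz_ball [ProperSpace E]
    (hf : LocallyLipschitz f) (R : ℝ) :
    ∃ L : ℝ, 0 ≤ L ∧ ∀ x y, ‖x‖ ≤ R → ‖y‖ ≤ R → f x - f y ≤ L * ‖x - y‖ := by
  obtain ⟨L, hL⟩ := hf.locallyLipschitzOn.exists_lipschitzOnWith_of_compact
    (isCompact_closedBall (0 : E) R)
  refine ⟨L, L.2, fun x y hx hy => ?_⟩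
  have := hL.dist_le_mul x (by simpa using hx) y (by simpa using hy)
  rw [Real.dist_eq, dist_eq_norm] at this
  exact (le_abs_self _).trans this

/-- The implicit Euler scheme is Lipschitz in time, uniformly in the step size. -/
theorem exists_lipschitz_isProximalSequence [ProperSpace E] (hf0 : ∀ x, 0 ≤ f x)
    (hfl : LocallyLipschitz f) (z₀ : E) (T : ℝ) :
    ∃ L : ℝ, 0 ≤ L ∧ ∀ τ x, IsProximalSequence f C z₀ τ x → ∀ i d : ℕ, (i + d : ℕ) * τ ≤ T →
      ‖x (i + d) - x i‖ ≤ L * (d * τ) := by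
  obtain ⟨L, hL, hLf⟩ := hfl.exists_lipschitz_ball (‖z₀‖ + f z₀ + T)
  refine ⟨2 * L, by positivity, fun τ x h i d => ?_⟩
  have := h.pos
  induction d with
  | zero => simp
  | succ d ih =>
    intro hT
    have hT' : (i + d : ℕ) * τ ≤ T := by
      push_cast at hT ⊢
      linarith
    have h1 := ih hT'
    have h2 := (h.step (i + d)).norm_sub_le_of_lipschitz h.pos (h.mem _) hL
      ((hLf _ _ (h.norm_le hf0 hT') (h.norm_le hf0 hT)).trans_eq (by rw [norm_sub_rev, add_assoc]))
    have h3 := norm_sub_le_norm_sub_add_norm_sub (x (i + (d + 1))) (x (i + d)) (x i)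
    rw [← add_assoc] at h3 ⊢
    push_cast
    linarith

variable [InnerProductSpace ℝ E]

theorem exists_isProximalSequence [FiniteDimensional ℝ E] (hC : IsClosed C) (hfc : Continuous f)
    (hf0 : ∀ x, 0 ≤ f x) {z₀ : E} (hz₀ : z₀ ∈ C) {τ : ℝ} (hτ : 0 < τ) :
    ∃ x, IsProximalSequence f C z₀ τ x := by
  choose! S hS using fun x (hx : x ∈ C) => exists_isProximalStep hC hfc hf0 hτ hx
  have hmem : ∀ k, S^[k] z₀ ∈ C := fun k => by
    induction k with
    | zero => exact hz₀
    | succ k ih => rw [Function.iterate_succ_apply']; exact (hS _ ih).1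
  exact ⟨fun k => S^[k] z₀, rfl, hmem, fun k => by
    rw [Function.iterate_succ_apply']; exact hS _ (hmem k), hτ⟩

/-- The summed discrete evolution variational inequality. -/
theorem exists_evi_isProximalSequence [FiniteDimensional ℝ E] (hC : Convex ℝ C)
    (hf0 : ∀ x, 0 ≤ f x) (hfl : LocallyLipschitz f) (hfs : LocallySemiconvex f) (z₀ : E)
    (T ρ : ℝ) :
    ∃ K B : ℝ, ∀ y ∈ C, ‖y‖ ≤ ρ → ∀ τ x, IsProximalSequence f C z₀ τ x → ∀ i D : ℕ,
      (i + D : ℕ) * τ ≤ T → ‖y - x (i + D)‖ ^ 2 - ‖y - x i‖ ^ 2 ≤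
        (D * τ) * (2 * (f y - f (x i) + K * ‖y - x i‖ ^ 2) + B * (D * τ)) := by
  obtain ⟨S, hS, hlip⟩ := exists_lipschitz_isProximalSequence (C := C) hf0 hfl z₀ T
  set R := max (‖z₀‖ + f z₀ + T) ρ
  obtain ⟨L, hL, hLf⟩ := hfl.exists_lipschitz_ball R
  obtain ⟨K, hK, hineq⟩ := hfs.exists_subgradient_ineq hC R
  -- The cost of replacing the current iterate by `x i`: `L` accounts for the values of `f`, `K * (4
  -- * R)` for the squared distances, and `S` is the speed bound.
  set B := 2 * ((L + K * (4 * R)) * S)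
  refine ⟨K, B, fun y hy hyρ τ x h i D hT => ?_⟩
  have hτ := h.pos
  have hyR : ‖y‖ ≤ R := hyρ.trans (le_max_right _ _)
  have hR : 0 ≤ R := (norm_nonneg y).trans hyR
  have hB : 0 ≤ B := by positivity
  -- The error keeps the full length `D * τ` while `d` grows, so each step adds the same amount.
  have key : ∀ d ≤ D, ‖y - x (i + d)‖ ^ 2 - ‖y - x i‖ ^ 2 ≤
      (d * τ) * (2 * (f y - f (x i) + K * ‖y - x i‖ ^ 2) + B * (D * τ)) := by
    intro d
    induction d with
    | zero => simp
    | succ d ih =>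
      intro hd
      have hle : ∀ e ≤ D, (i + e : ℕ) * τ ≤ T := fun e he =>
        le_trans (by gcongr) hT
      have hxR : ∀ e ≤ D, ‖x (i + e)‖ ≤ R := fun e he =>
        (h.norm_le hf0 (hle e he)).trans (le_max_left _ _)
      have h1 := ih (by omega)
      have h2 : ‖y - x (i + (d + 1))‖ ^ 2 - ‖y - x (i + d)‖ ^ 2 ≤ 2 * τ *
          (f y - f (x (i + (d + 1))) + K * ‖y - x (i + (d + 1))‖ ^ 2) := evi_of_subgradient_ineq hτ (y := y) (K := K)
        (hineq _ _ _ ((h.step _).mem_clarkeSubdifferential hτ) hy (hxR (d + 1) hd) hyR)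
      have h3 : ‖x (i + (d + 1)) - x i‖ ≤ S * (D * τ) :=
        (hlip τ x h i (d + 1) (hle _ hd)).trans (by gcongr)
      have hxi : ‖x i‖ ≤ R := hxR 0 (by omega)
      have h4 : f (x i) - f (x (i + (d + 1))) ≤ L * (S * (D * τ)) :=
        (hLf _ _ hxi (hxR _ hd)).trans (by rw [norm_sub_rev]; gcongr)
      have h5 : ‖y - x (i + (d + 1))‖ ^ 2 - ‖y - x i‖ ^ 2 ≤ (4 * R) * (S * (D * τ)) := by
        have a1 : ‖y - x (i + (d + 1))‖ ≤ ‖y‖ + ‖x (i + (d + 1))‖ := _root_.norm_sub_le _ _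
        have a2 : ‖y - x i‖ ≤ ‖y‖ + ‖x i‖ := _root_.norm_sub_le _ _
        have a3 := hxR _ hd
        have a4 : ‖y - x (i + (d + 1))‖ - ‖y - x i‖ ≤ S * (D * τ) := by
          refine (norm_sub_norm_le _ _).trans ?_
          rw [sub_sub_sub_cancel_left, norm_sub_rev]
          exact h3
        have a5 : 0 ≤ S * (D * τ) := by positivity
        calc ‖y - x (i + (d + 1))‖ ^ 2 - ‖y - x i‖ ^ 2
            = (‖y - x (i + (d + 1))‖ + ‖y - x i‖) * (‖y - x (i + (d + 1))‖ - ‖y - x i‖) := by ring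
          _ ≤ (‖y - x (i + (d + 1))‖ + ‖y - x i‖) * (S * (D * τ)) := by gcongr
          _ ≤ (4 * R) * (S * (D * τ)) := by gcongr; linarith
      have h6 := mul_le_mul_of_nonneg_left h5 hK
      have h7 : 2 * τ * (f y - f (x (i + (d + 1))) + K * ‖y - x (i + (d + 1))‖ ^ 2) ≤
          τ * (2 * (f y - f (x i) + K * ‖y - x i‖ ^ 2) + B * (D * τ)) := by
        rw [mul_comm 2 τ, mul_assoc]
        refine mul_le_mul_of_nonneg_left ?_ hτ.le
        simp only [B]
        linarith
      push_cast
      linarith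
  exact key D le_rfl

end ProximalSequence

/-! ### Passage to the limit and existence -/

section Existence

variable {E : Type*} [NormedAddCommGroup E] [InnerProductSpace ℝ E] [FiniteDimensional ℝ E]
  {f : E → ℝ} {C : Set E}

theorem le_of_hasDerivAt_of_sub_le {φ : ℝ → ℝ} {d t A B : ℝ} (hφ : HasDerivAt φ d t)
    (h : ∀ s ∈ Ioo t (t + 1), φ s - φ t ≤ (s - t) * (A + B * (s - t))) : d ≤ A := by
  have h1 : Tendsto (slope φ t) (𝓝[>] t) (𝓝 d) :=
    (hasDerivAt_iff_tendsto_slope.1 hφ).mono_left (nhdsWithin_mono _ fun s hs => ne_of_gt hs)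
  have h2 : Tendsto (fun s => A + B * (s - t)) (𝓝[>] t) (𝓝 A) :=
    (Continuous.tendsto' (by fun_prop) t A (by simp)).mono_left nhdsWithin_le_nhds
  refine le_of_tendsto_of_tendsto h1 h2 ?_
  filter_upwards [Ioo_mem_nhdsGT (lt_add_one t)] with s hs
  rw [slope_def_field, div_le_iff₀ (sub_pos.2 hs.1), mul_comm]
  exact h s hs

/-- A pointwise limit of implicit Euler approximations, with the estimates that survive. -/
theorem exists_limit_curve (hCc : IsClosed C) (hC : Convex ℝ C) (hf0 : ∀ x, 0 ≤ f x)
    (hfl : LocallyLipschitz f) (hfs : LocallySemiconvex f) {z₀ : E} (hz₀ : z₀ ∈ C) :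
    ∃ z : ℝ → E, z 0 = z₀ ∧ (∀ t, z t ∈ C) ∧ (∀ t, f (z t) ≤ f z₀) ∧
      (∀ T, ∃ L : ℝ, 0 ≤ L ∧ ∀ s t, 0 ≤ s → s ≤ t → t ≤ T → ‖z t - z s‖ ≤ L * (t - s)) ∧
      ∀ T ρ, ∃ K B : ℝ, ∀ y ∈ C, ‖y‖ ≤ ρ → ∀ s t, 0 ≤ s → s ≤ t → t ≤ T →
        ‖y - z t‖ ^ 2 - ‖y - z s‖ ^ 2 ≤
          (t - s) * (2 * (f y - f (z s) + K * ‖y - z s‖ ^ 2) + B * (t - s)) := by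
  have hfc := hfl.continuous
  choose x hx using fun n : ℕ => exists_isProximalSequence hCc hfc hf0 hz₀
    (τ := 1 / ((n : ℝ) + 1)) (by positivity)
  -- Index of the last grid point before `t`; for negative `t` the floor is `0` and the curve rests
  -- at `z₀`.
  set k : ℕ → ℝ → ℕ := fun n t => ⌊t * ((n : ℝ) + 1)⌋₊ with hk
  have hτ : ∀ t, 0 ≤ t → Tendsto (fun n => (k n t : ℝ) * (1 / ((n : ℝ) + 1)))
      (hyperfilter ℕ : Filter ℕ) (𝓝 t) := fun t ht => by
    have h1 : Tendsto (fun n : ℕ => (n : ℝ) + 1) atTop atTop :=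
      tendsto_atTop_add_const_right _ _ tendsto_natCast_atTop_atTop
    have h2 := ((tendsto_nat_floor_mul_div_atTop ht).comp h1).mono_left Nat.hyperfilter_le_atTop
    refine h2.congr fun n => ?_
    simp [hk, div_eq_mul_inv]
  have hkle : ∀ n t, 0 ≤ t → (k n t : ℝ) * (1 / ((n : ℝ) + 1)) ≤ t := fun n t ht => by
    rw [mul_one_div, div_le_iff₀ (by positivity)]
    exact Nat.floor_le (by positivity)
  -- A single ultrafilter gives convergence at all times at once, without extracting subsequences.
  have hlim : ∀ t, ∃ a, Tendsto (fun n => x n (k n t)) (hyperfilter ℕ : Filter ℕ) (𝓝 a) := by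
    intro t
    have : ProperSpace E := FiniteDimensional.proper_real E
    have hmem : ∀ n, x n (k n t) ∈ Metric.closedBall (0 : E) (‖z₀‖ + f z₀ + max t 0) := fun n => by
      rw [mem_closedBall_zero_iff]
      refine (hx n).norm_le hf0 (le_trans ?_ (hkle n (max t 0) (le_max_right _ _)))
      gcongr
      exact Nat.floor_mono (by gcongr; exact le_max_left _ _)
    obtain ⟨a, -, ha⟩ := (isCompact_closedBall (0 : E) (‖z₀‖ + f z₀ + max t 0)).ultrafilter_le_nhds
      ((hyperfilter ℕ).map fun n => x n (k n t))
      (tendsto_principal.2 (Filter.Eventually.of_forall hmem))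
    exact ⟨a, ha⟩
  choose z hz using hlim
  have hmono : ∀ n s t, s ≤ t → k n s ≤ k n t := fun n s t hst => Nat.floor_mono (by gcongr)
  have hsub : ∀ n s t, s ≤ t → ((k n t - k n s : ℕ) : ℝ) * (1 / ((n : ℝ) + 1)) =
      k n t * (1 / ((n : ℝ) + 1)) - k n s * (1 / ((n : ℝ) + 1)) := fun n s t hst => by
    rw [Nat.cast_sub (hmono n s t hst), sub_mul]
  refine ⟨z, ?_, fun t => ?_, fun t => ?_, fun T => ?_, fun T ρ => ?_⟩
  · refine tendsto_nhds_unique (hz 0) (tendsto_const_nhds.congr fun n => ?_)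
    simp [hk, (hx n).zero]
  · exact hCc.mem_of_tendsto (hz t) (Filter.Eventually.of_forall fun n => (hx n).mem _)
  · exact le_of_tendsto ((hfc.tendsto _).comp (hz t))
      (Filter.Eventually.of_forall fun n => (hx n).apply_le _)
  · obtain ⟨L, hL, h⟩ := exists_lipschitz_isProximalSequence (C := C) hf0 hfl z₀ T
    refine ⟨L, hL, fun s t hs hst ht => ?_⟩
    refine le_of_tendsto_of_tendsto' ((hz t).sub (hz s)).norm
      (((hτ t (hs.trans hst)).sub (hτ s hs)).const_mul L) fun n => ?_
    have h1 := h _ _ (hx n) (k n s) (k n t - k n s)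
    rw [Nat.add_sub_cancel' (hmono n s t hst), hsub n s t hst] at h1
    exact h1 ((hkle n t (hs.trans hst)).trans ht)
  · obtain ⟨K, B, h⟩ := exists_evi_isProximalSequence hC hf0 hfl hfs z₀ T ρ
    refine ⟨K, B, fun y hy hyρ s t hs hst ht => ?_⟩
    have hd := (hτ t (hs.trans hst)).sub (hτ s hs)
    have hys := ((hz s).const_sub y).norm.pow 2
    refine le_of_tendsto_of_tendsto' ((((hz t).const_sub y).norm.pow 2).sub hys)
      (hd.mul ((((((hfc.tendsto _).comp (hz s)).const_sub (f y)).add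
        (hys.const_mul K)).const_mul 2).add (hd.const_mul B))) fun n => ?_
    have h1 := h y hy hyρ _ _ (hx n) (k n s) (k n t - k n s)
    rw [Nat.add_sub_cancel' (hmono n s t hst), hsub n s t hst] at h1
    exact h1 ((hkle n t (hs.trans hst)).trans ht)

/-- Global solutions of the subgradient inclusion exist, and the objective stays below its
initial value along them. -/
theorem exists_isSolution (hCc : IsClosed C) (hC : Convex ℝ C) (hf0 : ∀ x, 0 ≤ f x)
    (hfl : LocallyLipschitz f) (hfs : LocallySemiconvex f) {z₀ : E} (hz₀ : z₀ ∈ C) :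
    ∃ z : ℝ → E, z 0 = z₀ ∧ (∀ t, z t ∈ C) ∧ (∀ t, f (z t) ≤ f z₀) ∧
      IsSolution (clarkeSubdifferential (constrained f C)) (Ici 0) z := by
  obtain ⟨z, h0, hzC, hzf, hlip, hevi⟩ := exists_limit_curve hCc hC hf0 hfl hfs hz₀
  have hac : ∀ a ∈ Ici (0 : ℝ), ∀ b ∈ Ici (0 : ℝ), AbsolutelyContinuousOnInterval z a b := by
    intro a ha b hb
    obtain ⟨L, hL, h⟩ := hlip (max a b)
    refine LipschitzOnWith.absolutelyContinuousOnInterval (K := ⟨L, hL⟩)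
      (LipschitzOnWith.of_dist_le_mul fun s hs t ht => ?_)
    have hmin : 0 ≤ min a b := le_min ha hb
    rw [dist_eq_norm, Real.dist_eq]
    rcases le_total s t with hst | hst
    · rw [norm_sub_rev, abs_sub_comm, abs_of_nonneg (sub_nonneg.2 hst)]
      exact h s t (hmin.trans hs.1) hst ht.2
    · rw [abs_of_nonneg (sub_nonneg.2 hst)]
      exact h t s (hmin.trans ht.1) hst hs.2
  refine ⟨z, h0, hzC, hzf, ordConnected_Ici, subset_rfl, hac, ?_⟩
  have hdiff : ∀ᵐ t : ℝ, ∀ N : ℕ, t ∈ uIcc (0 : ℝ) N → DifferentiableAt ℝ z t :=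
    MeasureTheory.ae_all_iff.2 fun N => (hac 0 self_mem_Ici N
      (by simp)).boundedVariationOn.ae_differentiableAt_of_mem_uIcc
  filter_upwards [hdiff] with t ht ht0
  obtain ⟨N, hN⟩ := exists_nat_ge t
  have hd := (ht N (by rw [uIcc_of_le (by simp)]; exact ⟨ht0, hN⟩)).hasDerivAt
  refine ⟨-deriv z t, ?_, by simpa using hd⟩
  -- The horizon leaves room for right difference quotients at `t`; the radius covers the unit ball
  -- around `z t`.
  obtain ⟨K, B, h⟩ := hevi (t + 1) (‖z t‖ + 1)
  refine mem_clarkeSubdifferential_of_local_ineq (K := K) (hzC t) one_pos fun y hy hyt => ?_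
  have hyR : ‖y‖ ≤ ‖z t‖ + 1 := by
    linarith [norm_le_norm_add_norm_sub' y (z t)]
  have hφ : HasDerivAt (fun s => ‖y - z s‖ ^ 2) (2 * inner ℝ (y - z t) (-deriv z t)) t :=
    (hd.const_sub y).norm_sq
  have := le_of_hasDerivAt_of_sub_le hφ fun s hs => h y hy hyR t s ht0 hs.1.le hs.2.le
  rw [real_inner_comm] at this
  linarith

/-- Existence and uniqueness of the subgradient trajectory of a nonnegative, locally Lipschitz and
locally semiconvex function under a closed convex constraint. -/
theorem exists_unique_trajectory (hCc : IsClosed C) (hC : Convex ℝ C) (hf0 : ∀ x, 0 ≤ f x)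
    (hfl : LocallyLipschitz f) (hfs : LocallySemiconvex f) {z₀ : E} (hz₀ : z₀ ∈ C) :
    ∃ z : ℝ → E, z 0 = z₀ ∧ (∀ t, z t ∈ C) ∧ (∀ t, f (z t) ≤ f z₀) ∧
      IsSubgradientTrajectory (constrained f C) (Ici 0) z ∧
      ∀ (J : Set ℝ) (w : ℝ → E), IsSubgradientTrajectory (constrained f C) J w → 0 ∈ J →
        w 0 = z₀ → J = Ici 0 ∧ EqOn w z J := by
  obtain ⟨z, h0, hzC, hzf, hz⟩ := exists_isSolution hCc hC hf0 hfl hfs hz₀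
  refine ⟨z, h0, hzC, hzf, ⟨hz, fun J y hJ hIJ _ => hJ.subset_nonneg.antisymm hIJ⟩,
    fun J w hw h0J hw0 => ?_⟩
  have heq : EqOn z w J := fun t ht =>
    hfs.eq_of_isSolution hC hz hw.isSolution (hw.isSolution.subset_nonneg ht) self_mem_Ici
      (hw.isSolution.subset_nonneg ht) h0J ht (h0.trans hw0.symm)
  -- The global solution extends `w`, so maximality of `w` forces its interval to be everything.
  exact ⟨(hw.maximal _ z hz hw.isSolution.subset_nonneg heq).symm, heq.symm⟩

end Existence

/-! ### Composite functions and calculus lemmas -/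

section Composite

/-- A convex function composed with a map that is affine up to quadratic errors is
semiconvex on bounded sets. -/
theorem locallySemiconvex_comp {E V : Type*} [NormedAddCommGroup E] [InnerProductSpace ℝ E]
    [FiniteDimensional ℝ E] [NormedAddCommGroup V] [NormedSpace ℝ V] [FiniteDimensional ℝ V]
    {H : V → ℝ} {F : E → V} (hH : ConvexOn ℝ univ H) (hF : Continuous F) {c : ℝ}
    (hFc : ∀ x y, ∀ t ∈ Icc (0 : ℝ) 1,
      ‖F (x + t • (y - x)) - ((1 - t) • F x + t • F y)‖ ≤ c * t * ‖y - x‖ ^ 2) :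
    LocallySemiconvex fun x => H (F x) := by
  intro R
  have : ProperSpace V := FiniteDimensional.proper_real V
  obtain ⟨S, hS⟩ := (isCompact_closedBall (0 : E) R).exists_bound_of_continuousOn hF.continuousOn
  -- A convex function in finite dimension is locally Lipschitz, so the quadratic error of `F` costs
  -- only a factor `L`.
  obtain ⟨L, hL, hLH⟩ := hH.locallyLipschitz.exists_lipschitz_ball S
  refine ⟨L * max c 0, by positivity, fun x y hx hy t ht => ?_⟩
  have hx' := mem_closedBall_zero_iff.2 hx
  have hy' := mem_closedBall_zero_iff.2 hy
  have h1 := hS _ ((convex_closedBall (0 : E) R).add_smul_sub_mem hx' hy' ht)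
  have h2 : ‖(1 - t) • F x + t • F y‖ ≤ S := by
    rw [← mem_closedBall_zero_iff]
    exact convex_closedBall (0 : V) S (mem_closedBall_zero_iff.2 (hS x hx'))
      (mem_closedBall_zero_iff.2 (hS y hy')) (sub_nonneg.2 ht.2) ht.1 (by ring)
  have h3 := hLH _ _ h1 h2
  have h4 := hH.2 (mem_univ (F x)) (mem_univ (F y)) (sub_nonneg.2 ht.2) ht.1 (by ring)
  simp only [smul_eq_mul] at h4
  have h5 : ‖F (x + t • (y - x)) - ((1 - t) • F x + t • F y)‖ ≤ max c 0 * t * ‖y - x‖ ^ 2 := by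
    refine (hFc x y t ht).trans ?_
    have := ht.1
    gcongr
    exact le_max_left _ _
  have h6 := mul_le_mul_of_nonneg_left h5 hL
  linarith

theorem hasDerivAt_sum_sq_sub_sum_sq {E ι κ : Type*} [NormedAddCommGroup E] [NormedSpace ℝ E]
    [Fintype ι] [Fintype κ] (a : ι → E →L[ℝ] ℝ) (b : κ → E →L[ℝ] ℝ) {z : ℝ → E} {v : E} {t : ℝ}
    (hz : HasDerivAt z v t) :
    HasDerivAt (fun t => ∑ i, a i (z t) ^ 2 - ∑ j, b j (z t) ^ 2)
      (2 * (∑ i, a i (z t) * a i v - ∑ j, b j (z t) * b j v)) t := by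
  have key : ∀ c : E →L[ℝ] ℝ, HasDerivAt (fun t => c (z t) ^ 2) (2 * (c (z t) * c v)) t :=
    fun c => by simpa [mul_assoc] using (c.hasFDerivAt.comp_hasDerivAt t hz).fun_pow 2
  rw [mul_sub, Finset.mul_sum, Finset.mul_sum]
  exact (HasDerivAt.fun_sum fun i _ => key (a i)).fun_sub
    (HasDerivAt.fun_sum fun j _ => key (b j))

/-- The difference of the two sides has a local minimum at `c = 1`, where the displacement vanishes
and has velocity `a - b`. The quadratic term has zero derivative there, so Fermat's rule leaves the
pairing of `v` with `a - b`. -/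
theorem inner_sub_inner_eq_zero_of_eventually {E : Type*} [NormedAddCommGroup E]
    [InnerProductSpace ℝ E] {v a b : E} {K : ℝ}
    (h : ∀ᶠ c in 𝓝 (1 : ℝ), inner ℝ v ((c - 1) • a + (c⁻¹ - 1) • b) ≤
      K * ‖(c - 1) • a + (c⁻¹ - 1) • b‖ ^ 2) : inner ℝ v a - inner ℝ v b = 0 := by
  set g : ℝ → E := fun c => (c - 1) • a + (c⁻¹ - 1) • b with hg
  have hgd : HasDerivAt g (a - b) 1 := by
    have h1 := ((hasDerivAt_id (1 : ℝ)).sub_const 1).smul_const a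
    have h2 := ((hasDerivAt_inv (one_ne_zero (α := ℝ))).sub_const 1).smul_const b
    have e : a - b = (1 : ℝ) • a + (-((1 : ℝ) ^ 2)⁻¹) • b := by simp [sub_eq_add_neg]
    rw [e]
    exact h1.add h2
  have hg1 : g 1 = 0 := by simp [hg]
  have hd := (hgd.norm_sq.const_mul K).sub ((hasDerivAt_const (1 : ℝ) v).inner ℝ hgd)
  have hmin : IsLocalMin (fun c => K * ‖g c‖ ^ 2 - inner ℝ v (g c)) 1 := by
    filter_upwards [h] with c hc
    simp only [hg1, norm_zero, inner_zero_right]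
    linarith
  have := hmin.hasDerivAt_eq_zero hd
  simp only [hg1, inner_zero_left, inner_zero_right, inner_sub_right] at this
  linarith

theorem convexOn_abs_rpow {p : ℝ} (hp : 1 ≤ p) : ConvexOn ℝ univ fun s : ℝ => |s| ^ p := by
  refine ⟨convex_univ, fun x _ y _ a b ha hb hab => ?_⟩
  have h1 := (convexOn_rpow hp).2 (abs_nonneg x) (abs_nonneg y) ha hb hab
  refine le_trans ?_ h1
  refine Real.rpow_le_rpow (abs_nonneg _) ?_ (by linarith)
  refine (abs_add_le _ _).trans ?_
  simp [abs_mul, abs_of_nonneg ha, abs_of_nonneg hb]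

end Composite

/-! ### The matrix factorization loss -/

section Factorization

variable {m n r : ℕ}

/-- The entry `X i k` as a continuous linear functional. -/
def xEntry (i : Fin m) (k : Fin r) : FactorPair m n r →L[ℝ] ℝ :=
  EuclideanSpace.proj (i, k) ∘L WithLp.fstL 2 ℝ _ _

/-- The entry `Y j k` as a continuous linear functional. -/
def yEntry (j : Fin n) (k : Fin r) : FactorPair m n r →L[ℝ] ℝ :=
  EuclideanSpace.proj (j, k) ∘L WithLp.sndL 2 ℝ _ _

@[simp] theorem xEntry_apply (i : Fin m) (k : Fin r) (z : FactorPair m n r) :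
    xEntry i k z = z.X i k := rfl

@[simp] theorem yEntry_apply (j : Fin n) (k : Fin r) (z : FactorPair m n r) :
    yEntry j k z = z.Y j k := rfl

theorem abs_X_le (z : FactorPair m n r) (i : Fin m) (k : Fin r) : |z.X i k| ≤ ‖z‖ :=
  (PiLp.norm_apply_le z.fst (i, k)).trans (WithLp.norm_fst_le _ z)

theorem abs_Y_le (z : FactorPair m n r) (j : Fin n) (k : Fin r) : |z.Y j k| ≤ ‖z‖ :=
  (PiLp.norm_apply_le z.snd (j, k)).trans (WithLp.norm_snd_le _ z)

/-- The residual `X Yᵀ - M`, as a vector. -/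
def residual (M : Matrix (Fin m) (Fin n) ℝ) (z : FactorPair m n r) (q : Fin m × Fin n) : ℝ :=
  ∑ k, xEntry q.1 k z * yEntry q.2 k z - M q.1 q.2

theorem residual_eq (M : Matrix (Fin m) (Fin n) ℝ) (z : FactorPair m n r) (i : Fin m)
    (j : Fin n) : residual M z (i, j) = (z.X * z.Y.transpose - M) i j := by
  simp [residual, Matrix.mul_apply]

theorem contDiff_residual (M : Matrix (Fin m) (Fin n) ℝ) :
    ContDiff ℝ 1 (residual (r := r) M) := by
  unfold residual
  fun_prop

/-- Since `X Yᵀ` is bilinear, the interpolation error is exactly `-t * (1 - t)` times the product of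
the increments; each entry sums `r` terms of size at most `‖y - x‖ ^ 2`. -/
theorem norm_residual_segment_le (M : Matrix (Fin m) (Fin n) ℝ) (x y : FactorPair m n r) (t : ℝ)
    (ht : t ∈ Icc (0 : ℝ) 1) :
    ‖residual M (x + t • (y - x)) - ((1 - t) • residual M x + t • residual M y)‖ ≤
      r * t * ‖y - x‖ ^ 2 := by
  have ht0 := ht.1
  rw [pi_norm_le_iff_of_nonneg (by positivity)]
  intro q
  have key : (residual M (x + t • (y - x)) - ((1 - t) • residual M x + t • residual M y)) q =
      ∑ k, -(t * (1 - t)) * ((y - x).X q.1 k * (y - x).Y q.2 k) := by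
    simp only [residual, Pi.sub_apply, Pi.add_apply, Pi.smul_apply, smul_eq_mul, mul_sub,
      Finset.mul_sum, ← xEntry_apply, ← yEntry_apply, map_add, map_smul, map_sub]
    have : ∀ a b c d e : ℝ, a - e - (b - (1 - t) * e + (c - t * e)) = d ↔ a = b + c + d := by
      intro a b c d e
      constructor <;> intro h <;> linarith
    rw [this, ← Finset.sum_add_distrib, ← Finset.sum_add_distrib]
    exact Finset.sum_congr rfl fun k _ => by ring
  rw [key, Real.norm_eq_abs]
  calc |∑ k, -(t * (1 - t)) * ((y - x).X q.1 k * (y - x).Y q.2 k)|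
      ≤ ∑ k : Fin r, |-(t * (1 - t)) * ((y - x).X q.1 k * (y - x).Y q.2 k)| :=
        Finset.abs_sum_le_sum_abs _ _
    _ ≤ ∑ _k : Fin r, t * (‖y - x‖ * ‖y - x‖) := by
        refine Finset.sum_le_sum fun k _ => ?_
        rw [abs_mul, abs_mul, abs_neg, abs_of_nonneg (mul_nonneg ht0 (sub_nonneg.2 ht.2))]
        gcongr
        · nlinarith
        · exact abs_X_le _ _ _
        · exact abs_Y_le _ _ _
    _ = r * t * ‖y - x‖ ^ 2 := by simp; ring

/-- The function `q ↦ (1/p) ‖q‖_p^p`. -/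
def lpPower (p : ℝ) (q : Fin m × Fin n → ℝ) : ℝ := 1 / p * ∑ i, ∑ j, |q (i, j)| ^ p

theorem lpLoss_eq (p : ℝ) (M : Matrix (Fin m) (Fin n) ℝ) :
    lpLoss (r := r) p M = fun z => lpPower p (residual M z) := by
  ext z
  simp only [lpLoss, lpPower, residual_eq]

theorem convexOn_lpPower {p : ℝ} (hp : 1 ≤ p) :
    ConvexOn ℝ univ (lpPower p : (Fin m × Fin n → ℝ) → ℝ) := by
  have hp0 : 0 ≤ 1 / p := by positivity
  refine ⟨convex_univ, fun x _ y _ a b ha hb hab => ?_⟩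
  simp only [lpPower, smul_eq_mul]
  rw [mul_left_comm a, mul_left_comm b, ← mul_add]
  refine mul_le_mul_of_nonneg_left ?_ hp0
  simp only [Finset.mul_sum, ← Finset.sum_add_distrib]
  exact Finset.sum_le_sum fun i _ => Finset.sum_le_sum fun j _ =>
    (convexOn_abs_rpow hp).2 (mem_univ _) (mem_univ _) ha hb hab

variable {p : ℝ} {M : Matrix (Fin m) (Fin n) ℝ}

theorem locallySemiconvex_lpLoss (hp : 1 ≤ p) : LocallySemiconvex (lpLoss (r := r) p M) := by
  rw [lpLoss_eq]
  exact locallySemiconvex_comp (convexOn_lpPower hp) (contDiff_residual M).continuous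
    (norm_residual_segment_le M)

theorem locallyLipschitz_lpLoss (hp : 1 ≤ p) : LocallyLipschitz (lpLoss (r := r) p M) := by
  rw [lpLoss_eq]
  exact (convexOn_lpPower hp).locallyLipschitz.comp (contDiff_residual M).locallyLipschitz

theorem lpLoss_nonneg (hp : 1 ≤ p) (z : FactorPair m n r) : 0 ≤ lpLoss p M z := by
  unfold lpLoss
  positivity

theorem isClosed_nonnegPairs : IsClosed (nonnegPairs m n r) := by
  have : nonnegPairs m n r =
      {z | (∀ i k, 0 ≤ xEntry i k z) ∧ ∀ j k, 0 ≤ yEntry j k z} := rfl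
  rw [this]
  simp only [ofPred_and, ofPred_forall]
  exact (isClosed_iInter fun i => isClosed_iInter fun k =>
    isClosed_le continuous_const (xEntry i k).continuous).inter
    (isClosed_iInter fun i => isClosed_iInter fun k =>
    isClosed_le continuous_const (yEntry i k).continuous)

theorem convex_nonnegPairs : Convex ℝ (nonnegPairs m n r) := by
  intro x hx y hy a b ha hb _
  refine ⟨fun i k => ?_, fun j k => ?_⟩
  · rw [← xEntry_apply, map_add, map_smul, map_smul]
    exact add_nonneg (mul_nonneg ha (hx.1 i k)) (mul_nonneg hb (hy.1 i k))
  · rw [← yEntry_apply, map_add, map_smul, map_smul]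
    exact add_nonneg (mul_nonneg ha (hx.2 j k)) (mul_nonneg hb (hy.2 j k))

/-! ### Scaling symmetry and conserved balances -/

section Balance

/-- The pair obtained from `(X, Y)` by keeping only column `k` of `X`. -/
def colX (k : Fin r) (z : FactorPair m n r) : FactorPair m n r :=
  WithLp.toLp 2 (WithLp.toLp 2 fun q => if q.2 = k then z.X q.1 q.2 else 0, 0)

/-- The pair obtained from `(X, Y)` by keeping only column `k` of `Y`. -/
def colY (k : Fin r) (z : FactorPair m n r) : FactorPair m n r :=
  WithLp.toLp 2 (0, WithLp.toLp 2 fun q => if q.2 = k then z.Y q.1 q.2 else 0)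

theorem inner_colX (k : Fin r) (z v : FactorPair m n r) :
    inner ℝ v (colX k z) = ∑ i, z.X i k * v.X i k := by
  simp [colX, WithLp.prod_inner_apply, PiLp.inner_apply, Fintype.sum_prod_type, FactorPair.X]

theorem inner_colY (k : Fin r) (z v : FactorPair m n r) :
    inner ℝ v (colY k z) = ∑ j, z.Y j k * v.Y j k := by
  simp [colY, WithLp.prod_inner_apply, PiLp.inner_apply, Fintype.sum_prod_type, FactorPair.Y]

/-- Column `k` of `X` is multiplied, and column `k` of `Y` is divided, by `c`. -/
def colScale (k : Fin r) (c : ℝ) (z : FactorPair m n r) : FactorPair m n r :=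
  z + ((c - 1) • colX k z + (c⁻¹ - 1) • colY k z)

theorem colScale_X (k : Fin r) (c : ℝ) (z : FactorPair m n r) (i : Fin m) (l : Fin r) :
    (colScale k c z).X i l = if l = k then c * z.X i l else z.X i l := by
  by_cases h : l = k <;> simp [colScale, colX, colY, FactorPair.X, h]
  ring

theorem colScale_Y (k : Fin r) (c : ℝ) (z : FactorPair m n r) (j : Fin n) (l : Fin r) :
    (colScale k c z).Y j l = if l = k then c⁻¹ * z.Y j l else z.Y j l := by
  by_cases h : l = k <;> simp [colScale, colX, colY, FactorPair.Y, h]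
  ring

theorem colScale_mem {k : Fin r} {c : ℝ} (hc : 0 < c) {z : FactorPair m n r}
    (hz : z ∈ nonnegPairs m n r) : colScale k c z ∈ nonnegPairs m n r := by
  refine ⟨fun i l => ?_, fun j l => ?_⟩
  · have := hz.1 i l
    rw [colScale_X]
    split_ifs <;> positivity
  · have := hz.2 j l
    rw [colScale_Y]
    split_ifs <;> positivity

theorem lpLoss_colScale {k : Fin r} {c : ℝ} (hc : 0 < c) (z : FactorPair m n r) :
    lpLoss p M (colScale k c z) = lpLoss p M z := by
  have : residual M (colScale k c z) = residual M z := by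
    ext q
    simp only [residual, xEntry_apply, yEntry_apply, colScale_X, colScale_Y]
    congr 1
    refine Finset.sum_congr rfl fun l _ => ?_
    split_ifs
    · field_simp
    · rfl
  simp only [lpLoss_eq, this]

/-- The scaling invariance of the objective makes subgradients orthogonal to the direction
`(X_k, -Y_k)`. -/
theorem inner_eq_zero_of_mem_clarkeSubdifferential (hp : 1 ≤ p) {z v : FactorPair m n r}
    (hv : v ∈ clarkeSubdifferential (constrained (lpLoss p M) (nonnegPairs m n r)) z)
    (k : Fin r) : inner ℝ v (colX k z) - inner ℝ v (colY k z) = 0 := by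
  have hz := mem_of_mem_clarkeSubdifferential hv
  obtain ⟨K, -, h⟩ := (locallySemiconvex_lpLoss (M := M) (r := r) hp).exists_subgradient_ineq
    convex_nonnegPairs (‖z‖ + 1)
  have hcont : ContinuousAt (fun c : ℝ => (c - 1) • colX k z + (c⁻¹ - 1) • colY k z) 1 := by
    have : ContinuousAt (fun c : ℝ => c⁻¹) 1 := continuousAt_inv₀ one_ne_zero
    fun_prop
  refine inner_sub_inner_eq_zero_of_eventually (K := K) ?_
  have hsmall : ∀ᶠ c in 𝓝 (1 : ℝ), ‖(c - 1) • colX k z + (c⁻¹ - 1) • colY k z‖ < 1 :=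
    hcont.norm.eventually_lt_const (by simp)
  filter_upwards [hsmall, lt_mem_nhds (zero_lt_one (α := ℝ))] with c hc hc0
  -- The rescaled pair is feasible with the same loss, so only the pairing and the quadratic term
  -- remain.
  have h1 := h z v (colScale k c z) hv (colScale_mem hc0 hz) (by linarith)
    ((norm_add_le z _).trans (by linarith))
  rw [lpLoss_colScale hc0, colScale, add_sub_cancel_left] at h1
  linarith

/-- The difference of the squared norms of column `k` of `X` and column `k` of `Y`. -/
def balance (k : Fin r) (z : FactorPair m n r) : ℝ := ∑ i, z.X i k ^ 2 - ∑ j, z.Y j k ^ 2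

theorem contDiff_balance (k : Fin r) : ContDiff ℝ 1 (balance (m := m) (n := n) k) := by
  have : ContDiff ℝ 1 fun z : FactorPair m n r =>
      ∑ i, xEntry i k z ^ 2 - ∑ j, yEntry j k z ^ 2 := by fun_prop
  exact this

/-- The column-wise balances are conserved along solutions. -/
theorem balance_eq (hp : 1 ≤ p) {I : Set ℝ} {z : ℝ → FactorPair m n r}
    (hz : IsSolution (clarkeSubdifferential (constrained (lpLoss p M) (nonnegPairs m n r))) I z)
    {a b : ℝ} (ha : a ∈ I) (hb : b ∈ I) (k : Fin r) : balance k (z b) = balance k (z a) := by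
  have hac : AbsolutelyContinuousOnInterval (fun t => balance k (z t)) a b :=
    (hz.absolutelyContinuous a ha b hb).locallyLipschitz_comp
      (contDiff_balance k).locallyLipschitz
  have hder : ∀ᵐ t : ℝ, t ∈ uIcc a b → HasDerivAt (fun t => balance k (z t)) 0 t := by
    filter_upwards [hz.inclusion] with t ht htI
    obtain ⟨v, hv, hd⟩ := ht (hz.ordConnected.uIcc_subset ha hb htI)
    have h := hasDerivAt_sum_sq_sub_sum_sq (fun i => xEntry i k) (fun j => yEntry j k) hd
    have h0 := inner_eq_zero_of_mem_clarkeSubdifferential hp hv k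
    rw [inner_colX, inner_colY] at h0
    simp only [xEntry_apply, yEntry_apply] at h
    have e : 2 * (∑ i, (z t).X i k * (-v).X i k - ∑ j, (z t).Y j k * (-v).Y j k) = 0 := by
      simp only [← xEntry_apply, ← yEntry_apply, map_neg, mul_neg, Finset.sum_neg_distrib] at h0 ⊢
      linarith
    rw [e] at h
    exact h
  obtain ⟨c, hc⟩ := hac.const_of_ae_hasDerivAt_zero hder
  rw [hc b right_mem_uIcc, hc a left_mem_uIcc]

end Balance

/-! ### Bounds from the loss and the balances -/

section Boundedness

/-- The entries of the residual are controlled by the loss. -/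
theorem abs_residual_le (hp : 1 ≤ p) (z : FactorPair m n r) (i : Fin m) (j : Fin n) :
    |(z.X * z.Y.transpose - M) i j| ≤ 1 + p * lpLoss p M z := by
  set s := |(z.X * z.Y.transpose - M) i j| with hs
  have h1 : s ^ p ≤ p * lpLoss p M z := by
    rw [lpLoss, ← mul_assoc, mul_one_div_cancel (by positivity), one_mul]
    refine le_trans ?_ (Finset.single_le_sum (f := fun i => ∑ j,
      |(z.X * z.Y.transpose - M) i j| ^ p) (fun i _ => by positivity) (Finset.mem_univ i))
    exact Finset.single_le_sum (f := fun j => |(z.X * z.Y.transpose - M) i j| ^ p)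
      (fun j _ => by positivity) (Finset.mem_univ j)
  -- Either `s ≤ 1` or `s ≤ s ^ p`, whence the summand `1`.
  rcases le_total s 1 with h | h
  · have : 0 ≤ s ^ p := by positivity
    linarith
  · have := Real.rpow_le_rpow_of_exponent_le h hp
    rw [Real.rpow_one] at this
    linarith

/-- The products of entries of nonnegative factors are controlled by the loss. -/
theorem X_mul_Y_le (hp : 1 ≤ p) {z : FactorPair m n r} (hz : z ∈ nonnegPairs m n r)
    (i : Fin m) (j : Fin n) (k : Fin r) :
    z.X i k * z.Y j k ≤ 1 + p * lpLoss p M z + ∑ i, ∑ j, |M i j| := by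
  have h1 : z.X i k * z.Y j k ≤ (z.X * z.Y.transpose) i j := by
    rw [Matrix.mul_apply]
    exact Finset.single_le_sum (f := fun k => z.X i k * z.Y.transpose k j)
      (fun k _ => mul_nonneg (hz.1 i k) (hz.2 j k)) (Finset.mem_univ k)
  have h2 := (le_abs_self _).trans (abs_residual_le (M := M) hp z i j)
  have h3 : |M i j| ≤ ∑ i, ∑ j, |M i j| :=
    (Finset.single_le_sum (f := fun j => |M i j|) (fun j _ => abs_nonneg _)
      (Finset.mem_univ j)).trans
    (Finset.single_le_sum (f := fun i => ∑ j, |M i j|) (fun i _ => by positivity)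
      (Finset.mem_univ i))
  have h4 := le_abs_self (M i j)
  rw [Matrix.sub_apply] at h2
  linarith

theorem norm_sq_eq_sum (z : FactorPair m n r) :
    ‖z‖ ^ 2 = ∑ k, (∑ i, z.X i k ^ 2 + ∑ j, z.Y j k ^ 2) := by
  rw [WithLp.prod_norm_sq_eq_of_L2, EuclideanSpace.real_norm_sq_eq,
    EuclideanSpace.real_norm_sq_eq, Fintype.sum_prod_type_right, Fintype.sum_prod_type_right,
    Finset.sum_add_distrib]
  rfl

/-- Bounds on the entrywise products and on the balances bound the pair. -/
theorem norm_sq_le {z : FactorPair m n r} {d : ℝ} (hd : ∀ i j k, |z.X i k * z.Y j k| ≤ d) :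
    ‖z‖ ^ 2 ≤ ∑ k, 2 * (m * n * d ^ 2 + |balance k z| + 1) := by
  rw [norm_sq_eq_sum]
  refine Finset.sum_le_sum fun k _ => ?_
  have hab : (∑ i, z.X i k ^ 2) * (∑ j, z.Y j k ^ 2) ≤ m * n * d ^ 2 := by
    rw [Finset.sum_mul_sum]
    calc ∑ i, ∑ j, z.X i k ^ 2 * z.Y j k ^ 2 ≤ ∑ _i : Fin m, ∑ _j : Fin n, d ^ 2 := by
          refine Finset.sum_le_sum fun i _ => Finset.sum_le_sum fun j _ => ?_
          rw [← mul_pow, ← sq_abs]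
          exact pow_le_pow_left₀ (abs_nonneg _) (hd i j k) 2
      _ = m * n * d ^ 2 := by simp; ring
  have ha : 0 ≤ ∑ i, z.X i k ^ 2 := by positivity
  have hb : 0 ≤ ∑ j, z.Y j k ^ 2 := by positivity
  have h1 := le_abs_self (balance k z)
  have h2 := neg_abs_le (balance k z)
  have h3 : 0 ≤ (m : ℝ) * n * d ^ 2 := by positivity
  have h4 : balance k z = ∑ i, z.X i k ^ 2 - ∑ j, z.Y j k ^ 2 := rfl
  have h5 := abs_nonneg (balance k z)
  generalize ∑ i, z.X i k ^ 2 = a at *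
  generalize ∑ j, z.Y j k ^ 2 = b at *
  generalize (m : ℝ) * n * d ^ 2 = D at *
  generalize |balance k z| = c at *
  -- Were both larger, `a * b` would exceed `(D + 1) ^ 2 > D`. The balance then controls the other
  -- one.
  have hmin : a ≤ D + 1 ∨ b ≤ D + 1 := by
    by_contra! h
    nlinarith
  rcases hmin with h | h <;> nlinarith

end Boundedness

end Factorization

end NMFlow

end

/-! ### The main theorem -/

theorem mainTheorem6 (m n r : ℕ) (p : ℝ) (hp : 1 ≤ p) (M : Matrix (Fin m) (Fin n) ℝ)
    (z₀ : NMFlow.FactorPair m n r)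
    (hz₀ : z₀ ∈ NMFlow.dom (NMFlow.nmfObjective (r := r) p M)) :
    ∃ z : ℝ → NMFlow.FactorPair m n r,
      -- existence of a subgradient trajectory starting at `z₀`, defined on `[0, ∞)`
      (NMFlow.IsSubgradientTrajectory (NMFlow.nmfObjective p M) (Set.Ici 0) z ∧ z 0 = z₀) ∧
      -- uniqueness among all subgradient trajectories starting at `z₀`
      (∀ (J : Set ℝ) (w : ℝ → NMFlow.FactorPair m n r),
        NMFlow.IsSubgradientTrajectory (NMFlow.nmfObjective p M) J w → 0 ∈ J → w 0 = z₀ →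
          J = Set.Ici 0 ∧ Set.EqOn w z J) ∧
      -- boundedness
      Bornology.IsBounded (z '' Set.Ici 0) ∧
      -- the column-wise balance is conserved
      (∀ k : Fin r, ∀ t : ℝ, 0 ≤ t →
        (∑ i, (z t).X i k ^ 2) - (∑ j, (z t).Y j k ^ 2)
          = (∑ i, z₀.X i k ^ 2) - (∑ j, z₀.Y j k ^ 2)) ∧
      -- the entrywise products are bounded
      (∃ d : ℝ, 0 < d ∧ ∀ t : ℝ, 0 ≤ t → ∀ i j k, |(z t).X i k * (z t).Y j k| ≤ d) := by
  have hΦ : NMFlow.nmfObjective p M =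
      NMFlow.constrained (NMFlow.lpLoss p M) (NMFlow.nonnegPairs m n r) := rfl
  rw [hΦ] at hz₀ ⊢
  have hC₀ : z₀ ∈ NMFlow.nonnegPairs m n r := by
    by_contra h
    exact (ne_of_lt hz₀) (NMFlow.constrained_of_notMem h)
  obtain ⟨z, h0, hzC, hzf, hz, huniq⟩ := NMFlow.exists_unique_trajectory
    NMFlow.isClosed_nonnegPairs NMFlow.convex_nonnegPairs (NMFlow.lpLoss_nonneg hp)
    (NMFlow.locallyLipschitz_lpLoss (M := M) hp) (NMFlow.locallySemiconvex_lpLoss hp) hC₀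
  have hbal : ∀ k t, 0 ≤ t → NMFlow.balance k (z t) = NMFlow.balance k z₀ := fun k t ht => by
    rw [NMFlow.balance_eq hp hz.isSolution Set.self_mem_Ici ht k, h0]
  -- The bound of `X_mul_Y_le` at the initial loss, valid at all times because the loss never
  -- exceeds it.
  set d : ℝ := 1 + p * NMFlow.lpLoss p M z₀ + ∑ i, ∑ j, |M i j| with hd
  have hd0 : 0 < d := by
    have := NMFlow.lpLoss_nonneg (M := M) hp z₀
    positivity
  have hprod : ∀ t i j k, |(z t).X i k * (z t).Y j k| ≤ d := fun t i j k => by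
    rw [abs_of_nonneg (mul_nonneg ((hzC t).1 i k) ((hzC t).2 j k))]
    refine (NMFlow.X_mul_Y_le (M := M) hp (hzC t) i j k).trans ?_
    have := mul_le_mul_of_nonneg_left (hzf t) (zero_le_one.trans hp)
    linarith
  refine ⟨z, ⟨hz, h0⟩, huniq, ?_, hbal, d, hd0, fun t _ => hprod t⟩
  rw [isBounded_iff_forall_norm_le]
  refine ⟨√(∑ k, 2 * (m * n * d ^ 2 + |NMFlow.balance k z₀| + 1)), ?_⟩
  rintro _ ⟨t, ht, rfl⟩
  refine Real.le_sqrt_of_sq_le ((NMFlow.norm_sq_le (hprod t)).trans_eq ?_)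
  simp only [hbal _ t ht]
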